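/- Let $p_1,\dots,p_k$ be distinct primes, $P=\{p_1,\dots,p_k\}$, and let $\mathcal A_P$ be the (countable, discrete) set of isomorphism classes of finite abelian groups $H$ such that every prime factor of $\#H$ lies in $P$. Let $\mathbb Y$ be the set of integer partitions $\lambda=(\lambda_1\ge\lambda_2\ge\cdots)$. For $\lambda\in\mathbb Y$ write $\lambda_j'=\#\{i:\lambda_i\ge j\}$, $|\lambda|=\sum_i\lambda_i$, $n(\lambda)=\sum_{i\ge1}(i-1)\lambda_i$, and $\mu'\succ\nu'$ if $\mu_1'\ge\nu_1'\ge\mu_2'\ge\nu_2'\ge\cdots$. Write $(a;q)_n=\prod_{i=1}^n(1-aq^{i-1})$, and for $\lambda(1),\dots,\lambda(k)\in\mathbb Y$ put $$G_{\lambda(1),\dots,\lambda(k)}(P)=\bigoplus_{i=1}^k\bigoplus_{j\ge1}\mathbb Z/p_i^{\lambda(i)_j}\mathbb Z .$$ Let $G$ be a random element of $\mathcal A_P$ whose moments $M_H:=\mathbb E[\#\operatorname{Sur}(G,H)]$, where $\operatorname{Sur}(G,H)$ is the set of surjective homomorphisms $G\to H$, are finite for all $H\in\mathcal A_P$. (1)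 For every $(\nu(1),\dots,\nu(k))\in\mathbb Y^k$, $$\Pr\bigl(G\cong G_{\nu(1),\dots,\nu(k)}(P)\bigr)=\sum_{\substack{(\mu(1),\dots,\mu(k))\in\mathbb Y^k\\ \mu(i)'\succ\nu(i)'\text{ for all }i}}\left(\prod_{i=1}^k\frac{(-1)^{|\mu(i)|-|\nu(i)|}\,p_i^{-n(\nu(i))-n(\mu(i))-|\mu(i)|}}{\prod_{j\ge1}(p_i^{-1};p_i^{-1})_{\mu(i)_j'-\nu(i)_j'}\,(p_i^{-1};p_i^{-1})_{\nu(i)_j'-\mu(i)_{j+1}'}}\right)M_{G_{\mu(1),\dots,\mu(k)}(P)},$$ provided that the sum on the right-hand side converges absolutely. (2) If this sum converges absolutely for every $(\nu(1),\dots,\nu(k))\in\mathbb Y^k$, then the law of $G$ is the unique probability measure on $\mathcal A_P$ with moments $M_H$, $H\in\mathcal A_P$. -/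

import Mathlib

open MeasureTheory

namespace RandomAbelianGroup

/-- A finite abelian group (written additively) such that every prime factor of its order lies
in `P`. -/
structure FinAbGroup (P : Set ℕ) where
  carrier : Type
  [group : AddCommGroup carrier]
  [finite : Finite carrier]
  prime_mem : ∀ q : ℕ, q.Prime → q ∣ Nat.card carrier → q ∈ P

attribute [instance] FinAbGroup.group FinAbGroup.finite

/-- Two groups are equivalent when they are isomorphic. -/
instance isoSetoid (P : Set ℕ) : Setoid (FinAbGroup P) where
  r G H := Nonempty (G.carrier ≃+ H.carrier)
  iseqv :=
    ⟨fun _ => ⟨AddEquiv.refl _⟩, fun ⟨e⟩ => ⟨e.symm⟩, fun ⟨e⟩ ⟨f⟩ => ⟨e.trans f⟩⟩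

/-- The set `𝒜_P` of isomorphism classes of finite abelian groups `H` such that every prime
factor of `#H` lies in `P`. -/
def IsoClass (P : Set ℕ) : Type 1 := Quotient (isoSetoid P)

/-- `𝒜_P` is a discrete space: every subset is measurable. -/
instance (P : Set ℕ) : MeasurableSpace (IsoClass P) := ⊤

/-- The number of surjective homomorphisms `A → B`. -/
noncomputable def surCard (A B : Type) [AddCommGroup A] [AddCommGroup B] : ℕ :=
  Nat.card {φ : A →+ B // Function.Surjective φ}

theorem surCard_congr {A A' B B' : Type} [AddCommGroup A] [AddCommGroup A'] [AddCommGroup B]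
    [AddCommGroup B'] (e : A ≃+ A') (f : B ≃+ B') : surCard A B = surCard A' B' := by
  refine Nat.card_congr
    { toFun := fun φ => ⟨f.toAddMonoidHom.comp (φ.1.comp e.symm.toAddMonoidHom),
        f.surjective.comp (φ.2.comp e.symm.surjective)⟩
      invFun := fun φ => ⟨f.symm.toAddMonoidHom.comp (φ.1.comp e.toAddMonoidHom),
        f.symm.surjective.comp (φ.2.comp e.surjective)⟩
      left_inv := ?_
      right_inv := ?_ }
  · rintro ⟨φ, hφ⟩
    ext x
    simp
  · rintro ⟨φ, hφ⟩
    ext x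
    simp

/-- `# Sur(G, H)` for isomorphism classes `G` and `H`. -/
noncomputable def sur {P : Set ℕ} (G H : IsoClass P) : ℕ :=
  Quotient.liftOn₂ G H (fun A B => surCard A.carrier B.carrier)
    (fun _ _ _ _ ⟨e⟩ ⟨f⟩ => surCard_congr e f)

/-- The `H`-moment `𝔼[# Sur(G, H)]` (possibly infinite) of a random group `G`. -/
noncomputable def moment {P : Set ℕ} {Ω : Type*} [MeasurableSpace Ω] (ℙ : Measure Ω)
    (G : Ω → IsoClass P) (H : IsoClass P) : ENNReal :=
  ∫⁻ ω, (sur (G ω) H : ENNReal) ∂ℙ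

/-! Partitions are Young diagrams, with rows and columns numbered from `0`: the part `λ_i` is
`lam.rowLen (i - 1)`, the part `λ_i'` of the conjugate partition is `lam.colLen (i - 1)`, the
number of nonzero parts is `lam.colLen 0`, and `|λ|` is `lam.card`. -/

/-- `G_{λ,p} = ⨁_i ℤ/p^{λ_i}ℤ`, the sum running over the nonzero parts `λ_i`. -/
abbrev PGroup (p : ℕ) (lam : YoungDiagram) : Type :=
  (j : Fin (lam.colLen 0)) → ZMod (p ^ lam.rowLen j)

/-- The isomorphism class of `G_{λ(1),…,λ(k)}(P) = ⨁_i G_{λ(i),p_i}`, for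
`P = {p_1, …, p_k}`. -/
def stdGroup {k : ℕ} (p : Fin k → ℕ) (hp : ∀ i, (p i).Prime) (lam : Fin k → YoungDiagram) :
    IsoClass (Set.range p) :=
  haveI : ∀ i, NeZero (p i) := fun i => ⟨(hp i).ne_zero⟩
  Quotient.mk (isoSetoid (Set.range p))
    { carrier := (i : Fin k) → PGroup (p i) (lam i)
      prime_mem := by
        intro q hq hdvd
        simp only [Nat.card_pi, Nat.card_zmod] at hdvd
        obtain ⟨i, -, hi⟩ := (hq.prime.dvd_finsetProd_iff _).1 hdvd
        obtain ⟨j, -, hj⟩ := (hq.prime.dvd_finsetProd_iff _).1 hi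
        exact ⟨i, ((Nat.prime_dvd_prime_iff_eq hq (hp i)).1 (hq.dvd_of_dvd_pow hj)).symm⟩ }

/-- `n(λ) = ∑_{i ≥ 1} (i - 1) λ_i`. -/
def nStat (lam : YoungDiagram) : ℕ := ∑ i ∈ Finset.range (lam.colLen 0), i * lam.rowLen i

/-- The `q`-Pochhammer symbol `(a; q)_n = ∏_{i=1}^n (1 - a q^{i-1})`. -/
def qPoch (a q : ℝ) (n : ℕ) : ℝ := ∏ i ∈ Finset.range n, (1 - a * q ^ i)

/-- The interlacing `μ' ≻ ν'` of the conjugates: `μ_1' ≥ ν_1' ≥ μ_2' ≥ ν_2' ≥ ⋯`. -/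
def ConjInterlaces (mu nu : YoungDiagram) : Prop :=
  ∀ j, nu.colLen j ≤ mu.colLen j ∧ mu.colLen (j + 1) ≤ nu.colLen j

/-- The inversion coefficient for a single prime `p` (used only when `μ' ≻ ν'`, so that the
subtractions of column lengths are genuine; all but finitely many factors of the product
over `j` are `1`):
`(-1)^{|μ|-|ν|} p^{-n(ν)-n(μ)-|μ|} /
  ∏_{j ≥ 1} (p⁻¹; p⁻¹)_{μ_j' - ν_j'} (p⁻¹; p⁻¹)_{ν_j' - μ_{j+1}'}`. -/
noncomputable def invCoeff (p : ℕ) (nu mu : YoungDiagram) : ℝ :=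
  (-1 : ℝ) ^ ((mu.card : ℤ) - (nu.card : ℤ)) *
      (p : ℝ) ^ (-(nStat nu : ℤ) - (nStat mu : ℤ) - (mu.card : ℤ)) /
    ∏ᶠ j : ℕ, qPoch (p : ℝ)⁻¹ (p : ℝ)⁻¹ (mu.colLen j - nu.colLen j) *
      qPoch (p : ℝ)⁻¹ (p : ℝ)⁻¹ (nu.colLen j - mu.colLen (j + 1))

/-- The summand of index `(μ(1), …, μ(k))` in the inversion formula at `(ν(1), …, ν(k))`, for
moments `M_H`. The index set consists of the tuples with `μ(i)' ≻ ν(i)'` for all `i`. -/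
noncomputable def invTerm {k : ℕ} (p : Fin k → ℕ) (hp : ∀ i, (p i).Prime)
    (M : IsoClass (Set.range p) → ℝ) (nu : Fin k → YoungDiagram)
    (mu : {mu : Fin k → YoungDiagram // ∀ i, ConjInterlaces (mu i) (nu i)}) : ℝ :=
  (∏ i, invCoeff (p i) (nu i) (mu.1 i)) * M (stdGroup p hp mu.1)

end RandomAbelianGroup

namespace RandomAbelianGroup

/-! ### Counting surjections onto a finite abelian `p`-group -/

/-! Conditioning on the value of G gives M_H as the sum over λ of #Sur(G_λ, H) · Pr(G ≅ G_λ). The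
theorem says that the coefficients c(ν, μ) of the formula invert this infinite linear system, which
rests on the orthogonality Σ_μ c(ν, μ) #Sur(G_λ, G_μ) = δ_{λν}
(`exists_sum_invCoeffExt_mul_surCard`, `hasSum_invCoeffPi_mul_sur`). For fixed λ and ν only finitely
many terms are nonzero, because G_λ surjects onto G_μ only if μ' ≤ λ' columnwise.

For one prime, put t = 1/p. Lifting surjections from their reductions mod p counts #Sur(G_λ, G_μ) as
a product over columns (`surCard_pGroup_eq_prod_cols`), and c(ν, μ) is such a product too. After
moving one ratio to the next column, each factor involves a single column length x = μ_j', which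
interlacing confines to [ν_j', ν_{j-1}'] for j > 1. The sum over μ is thus a product of one-variable
sums. If λ = ν, each of them is 1. Otherwise take the first column where λ' and ν' differ: the moved
ratio is 1 there, and the sum is empty of nonzero terms if λ_j' < ν_j', or a vanishing alternating
q-binomial sum if λ_j' > ν_j'. Distinct primes do not interact, so the general case is a product.

Since surjection counts and probabilities are nonnegative, absolute convergence of the inversion
series is absolute summability of the double family over (μ, λ). Exchanging the two sums proves (1).
For (2), the formula recovers each atom from the moments, and 𝒜_P is countable. -/

theorem card_comap_of_le_range {A V : Type*} [AddCommGroup A] [AddCommGroup V] (f : A →+ V)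
    {S : AddSubgroup V} (hS : S ≤ f.range) :
    Nat.card (S.comap f) = Nat.card f.ker * Nat.card S := by
  have h := AddSubgroup.relIndex_mul_relIndex ⊥ f.ker (S.comap f) bot_le
    (fun x hx => by simp [AddMonoidHom.mem_ker.1 hx, S.zero_mem])
  rw [AddSubgroup.relIndex_bot_left, AddSubgroup.relIndex_bot_left, AddSubgroup.relIndex_ker,
    AddSubgroup.map_comap_eq_self hS] at h
  exact h.symm

/-- The number of tuples `a` such that the vectors `f i (a i)` are linearly independent, when the
ranges of the homomorphisms `f i` increase with `i`. -/
theorem card_linearIndependent_apply {p : ℕ} [Fact p.Prime] {V : Type*} [AddCommGroup V]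
    [Module (ZMod p) V] [Finite V] : ∀ {r : ℕ} {A : Fin r → Type*} [∀ i, AddCommGroup (A i)]
    [∀ i, Finite (A i)] (f : ∀ i, A i →+ V), (∀ i j, i ≤ j → (f i).range ≤ (f j).range) →
    Nat.card {a : ∀ i, A i // LinearIndependent (ZMod p) fun i => f i (a i)} =
      ∏ i, (Nat.card (A i) - Nat.card (f i).ker * p ^ (i : ℕ))
  | 0, A, _, _, f, _ => by
    have : Unique {a : ∀ i, A i // LinearIndependent (ZMod p) fun i => f i (a i)} :=
      { default := ⟨fun i => i.elim0, linearIndependent_empty_type⟩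
        uniq := fun a => Subtype.ext (funext fun i => i.elim0) }
    simp
  | r + 1, A, _, _, f, hf => by
    classical
    cases nonempty_fintype {b : ∀ i : Fin r, A i.castSucc //
      LinearIndependent (ZMod p) fun i => f i.castSucc (b i)}
    have ih := card_linearIndependent_apply (p := p) (fun i : Fin r => f i.castSucc)
      (fun i j hij => hf _ _ (Fin.castSucc_le_castSucc_iff.2 hij))
    let W (b : ∀ i : Fin r, A i.castSucc) : Submodule (ZMod p) V :=
      Submodule.span (ZMod p) (Set.range fun i => f i.castSucc (b i))
    let e : {a : ∀ i, A i // LinearIndependent (ZMod p) fun i => f i (a i)} ≃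
        Σ b : {b : ∀ i : Fin r, A i.castSucc //
          LinearIndependent (ZMod p) fun i => f i.castSucc (b i)},
          {x : A (Fin.last r) // f _ x ∉ W b.1} :=
      { toFun := fun a => ⟨⟨Fin.init a.1, (linearIndependent_finSucc'.1 a.2).1⟩,
          ⟨a.1 (Fin.last r), (linearIndependent_finSucc'.1 a.2).2⟩⟩
        invFun := fun b => ⟨Fin.snoc (α := A) b.1.1 b.2.1, by
          rw [linearIndependent_finSucc']
          have h1 : (Fin.init fun i => f i (Fin.snoc (α := A) b.1.1 b.2.1 i)) =
              fun i : Fin r => f i.castSucc (b.1.1 i) := by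
            funext i
            simp [Fin.init]
          rw [h1]
          refine ⟨b.1.2, ?_⟩
          rw [Fin.snoc_last]
          exact b.2.2⟩
        left_inv := fun a => Subtype.ext (Fin.snoc_init_self a.1)
        right_inv := by
          rintro ⟨⟨b, hb⟩, ⟨x, hx⟩⟩
          have h1 : Fin.init (Fin.snoc (α := A) b x) = b := Fin.init_snoc _ _
          have h2 : Fin.snoc (α := A) b x (Fin.last r) = x := Fin.snoc_last _ _
          refine Sigma.ext (Subtype.ext h1) ?_
          refine (Subtype.heq_iff_coe_eq fun y => ?_).2 h2
          simp only [h1] }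
    have key (b : {b : ∀ i : Fin r, A i.castSucc //
          LinearIndependent (ZMod p) fun i => f i.castSucc (b i)}) :
        Nat.card {x : A (Fin.last r) // f _ x ∉ W b.1} =
          Nat.card (A (Fin.last r)) - Nat.card (f (Fin.last r)).ker * p ^ r := by
      have hle : (W b.1).toAddSubgroup ≤ (f (Fin.last r)).range := by
        have : W b.1 ≤ AddSubgroup.toZModSubmodule p (f (Fin.last r)).range := by
          refine Submodule.span_le.2 ?_
          rintro _ ⟨i, rfl⟩
          exact hf _ _ (Fin.le_last i.castSucc) ⟨_, rfl⟩
        exact this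
      -- The last vector must avoid the span of the earlier ones. This span has p^r elements and
      -- lies in the last range, so its preimage has #ker · p^r elements whatever the earlier
      -- choices were.
      have hW : Nat.card (W b.1) = p ^ r := by
        rw [Module.natCard_eq_pow_finrank (K := ZMod p), finrank_span_eq_card b.2, Nat.card_zmod,
          Fintype.card_fin]
      have h2 := card_comap_of_le_range _ hle
      have h3 : Nat.card (W b.1).toAddSubgroup = p ^ r := hW
      rw [h3] at h2
      have h4 := Nat.card_congr (Equiv.sumCompl fun x : A (Fin.last r) => f _ x ∈ W b.1)
      rw [Nat.card_sum] at h4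
      have h5 : Nat.card {x : A (Fin.last r) // f _ x ∈ W b.1} =
        Nat.card ((W b.1).toAddSubgroup.comap (f (Fin.last r))) := rfl
      omega
    rw [Nat.card_congr e, Nat.card_sigma, Finset.sum_congr rfl fun b _ => key b, Finset.sum_const,
      Finset.card_univ, ← Nat.card_eq_fintype_card, ih, Fin.prod_univ_castSucc]
    simp

/-- Reduction `ℤ/p^mℤ → ℤ/pℤ`. -/
def reduction (p : ℕ) {m : ℕ} (hm : m ≠ 0) : ZMod (p ^ m) →+ ZMod p :=
  (ZMod.castHom (dvd_pow_self p hm) (ZMod p)).toAddMonoidHom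

theorem exists_eq_nsmul_of_reduction_eq_zero {p m : ℕ} (hm : m ≠ 0) {x : ZMod (p ^ m)}
    (hx : reduction p hm x = 0) : ∃ y, x = p • y := by
  obtain ⟨n, rfl⟩ := ZMod.intCast_surjective x
  have h : ((n : ℤ) : ZMod p) = 0 := by
    rw [← hx]
    exact (map_intCast (ZMod.castHom (dvd_pow_self p hm) (ZMod p)) n).symm
  obtain ⟨k, rfl⟩ := (ZMod.intCast_zmod_eq_zero_iff_dvd _ _).1 h
  exact ⟨k, by simp⟩

theorem reduction_nsmul (p : ℕ) {m : ℕ} (hm : m ≠ 0) (x : ZMod (p ^ m)) :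
    reduction p hm (p • x) = 0 := by
  rw [map_nsmul]
  simp

section Reduction

variable {p : ℕ} [Fact p.Prime] {r : ℕ} {m : Fin r → ℕ} {A : Type*} [AddCommGroup A]

/-- A homomorphism to a finite abelian `p`-group is onto as soon as it is onto modulo `p`. -/
theorem surjective_of_surjective_reduction (hm : ∀ i, m i ≠ 0)
    (φ : A →+ ∀ i, ZMod (p ^ m i))
    (h : ∀ v : Fin r → ZMod p, ∃ a, ∀ i, reduction p (hm i) (φ a i) = v i) :
    Function.Surjective φ := by
  have step : ∀ y, ∃ a z, y = φ a + p • z := by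
    intro y
    obtain ⟨a, ha⟩ := h fun i => reduction p (hm i) (y i)
    have : ∀ i, ∃ z, (y - φ a) i = p • z := fun i =>
      exists_eq_nsmul_of_reduction_eq_zero (hm i) (by simp [ha i])
    choose z hz using this
    refine ⟨a, z, ?_⟩
    have : y - φ a = p • z := funext hz
    rw [← this]
    abel
  have iter : ∀ n : ℕ, ∀ y, ∃ a z, y = φ a + p ^ n • z := by
    intro n
    induction n with
    | zero => exact fun y => ⟨0, y, by simp⟩
    | succ n ih =>
      intro y
      obtain ⟨a, z, rfl⟩ := ih y
      obtain ⟨b, w, rfl⟩ := step z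
      exact ⟨a + p ^ n • b, w, by simp only [map_add, map_nsmul, pow_succ, mul_smul, smul_add]; abel⟩
  intro y
  -- The exponent ∑ m_i dominates every m_i, so this power of p kills the target and the error term
  -- vanishes.
  obtain ⟨a, z, rfl⟩ := iter (∑ i, m i) y
  refine ⟨a, ?_⟩
  have : p ^ (∑ i, m i) • z = 0 := by
    funext i
    have hd : p ^ m i ∣ p ^ (∑ i, m i) :=
      pow_dvd_pow _ (Finset.single_le_sum (f := m) (fun _ _ => Nat.zero_le _) (Finset.mem_univ i))
    have h0 : ((p ^ (∑ i, m i) : ℕ) : ZMod (p ^ m i)) = 0 := (ZMod.natCast_eq_zero_iff _ _).2 hd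
    rw [Pi.smul_apply, nsmul_eq_mul, h0, zero_mul, Pi.zero_apply]
  rw [this, add_zero]

/-- A linear relation among the reduced coordinates is a functional on 𝔽_p^r vanishing on the image
of A, and such a nonzero functional exists exactly when that image is a proper subspace. -/
theorem surjective_iff_linearIndependent_reduction (hm : ∀ i, m i ≠ 0)
    (φ : ∀ i, A →+ ZMod (p ^ m i)) :
    Function.Surjective (AddMonoidHom.pi φ) ↔
      LinearIndependent (ZMod p) fun i => AddMonoidHom.compHom (reduction p (hm i)) (φ i) := by
  classical
  rw [Fintype.linearIndependent_iff]
  constructor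
  · intro h c hc i
    obtain ⟨a, ha⟩ := h (Pi.single i 1)
    have h1 := DFunLike.congr_fun hc a
    have h2 : ∀ j, reduction p (hm j) (φ j a) = if j = i then 1 else 0 := by
      intro j
      have : φ j a = (Pi.single i 1 : ∀ i, ZMod (p ^ m i)) j := congrFun ha j
      rw [this]
      by_cases hj : j = i
      · subst hj
        rw [Pi.single_eq_same, if_pos rfl]
        exact map_one (ZMod.castHom (dvd_pow_self p (hm j)) (ZMod p))
      · simp [hj]
    simpa [AddMonoidHom.finsetSum_apply, h2] using h1
  · intro h
    refine surjective_of_surjective_reduction hm _ fun v => ?_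
    let R : A →+ (Fin r → ZMod p) := AddMonoidHom.pi fun i => (reduction p (hm i)).comp (φ i)
    suffices hR : AddSubgroup.toZModSubmodule p R.range = ⊤ by
      have hv : v ∈ AddSubgroup.toZModSubmodule p R.range := hR ▸ Submodule.mem_top
      obtain ⟨a, rfl⟩ := hv
      exact ⟨a, fun i => rfl⟩
    by_contra hne
    obtain ⟨f, hf0, hf⟩ := Submodule.exists_le_ker_of_lt_top _ (lt_top_iff_ne_top.2 hne)
    apply hf0
    have hfx : ∀ x, f x = ∑ i, f (Pi.single i 1) * x i := by
      intro x
      conv_lhs => rw [pi_eq_sum_univ' x, map_sum]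
      refine Finset.sum_congr rfl fun i _ => ?_
      rw [map_smul, smul_eq_mul, mul_comm]
    have hc := h (fun i => f (Pi.single i 1)) (by
      ext a
      have h1 : f (R a) = 0 := hf ⟨a, rfl⟩
      rw [hfx] at h1
      simpa [AddMonoidHom.finsetSum_apply, R] using h1)
    refine LinearMap.ext fun x => ?_
    simp [hfx x, hc]

end Reduction

/-- Left exactness of Hom(A, -). -/
theorem card_ker_compHom {A B C D : Type*} [AddCommGroup A] [AddCommGroup B] [AddCommGroup C]
    [AddCommGroup D] (ι : B →+ C) (ρ : C →+ D) (hι : Function.Injective ι)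
    (hex : ι.range = ρ.ker) :
    Nat.card (AddMonoidHom.compHom ρ : (A →+ C) →+ (A →+ D)).ker = Nat.card (A →+ B) := by
  symm
  refine Nat.card_congr (Equiv.ofBijective (fun a => ⟨ι.comp a, ?_⟩) ⟨?_, ?_⟩)
  · rw [AddMonoidHom.mem_ker]
    ext x
    have : ι (a x) ∈ ρ.ker := hex ▸ ⟨a x, rfl⟩
    simpa using this
  · intro a b hab
    ext x
    exact hι (DFunLike.congr_fun (Subtype.ext_iff.1 hab) x)
  · rintro ⟨g, hg⟩
    have hmem : ∀ x, g x ∈ ι.range := by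
      intro x
      rw [hex, AddMonoidHom.mem_ker]
      exact DFunLike.congr_fun (AddMonoidHom.mem_ker.1 hg) x
    refine ⟨(AddMonoidHom.ofInjective hι).symm.toAddMonoidHom.comp (g.codRestrict _ hmem), ?_⟩
    refine Subtype.ext (AddMonoidHom.ext fun x => ?_)
    exact congrArg Subtype.val
      ((AddMonoidHom.ofInjective hι).apply_symm_apply (g.codRestrict ι.range hmem x))

/-- Multiplication by p embeds ℤ/p^{m-1}ℤ in ℤ/p^mℤ as the kernel of reduction mod p. -/
theorem card_ker_compHom_reduction {p : ℕ} (hp : p.Prime) {m : ℕ} (hm : m ≠ 0) {A : Type*}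
    [AddCommGroup A] :
    Nat.card (AddMonoidHom.compHom (reduction p hm) : (A →+ ZMod (p ^ m)) →+ _).ker =
      Nat.card (A →+ ZMod (p ^ (m - 1))) := by
  obtain ⟨s, rfl⟩ := Nat.exists_eq_succ_of_ne_zero hm
  have h0 : (zmultiplesHom (ZMod (p ^ (s + 1))) (p : ZMod (p ^ (s + 1)))) ((p ^ s : ℕ) : ℤ) = 0 := by
    simp only [zmultiplesHom_apply, zsmul_eq_mul, Int.cast_natCast]
    rw [← Nat.cast_mul, ← pow_succ, ZMod.natCast_self]
  let ι : ZMod (p ^ s) →+ ZMod (p ^ (s + 1)) := ZMod.lift (p ^ s) ⟨_, h0⟩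
  have hι : ∀ z : ℤ, ι (z : ZMod (p ^ s)) = ((p * z : ℤ) : ZMod (p ^ (s + 1))) := by
    intro z
    have := ZMod.lift_coe (p ^ s) ⟨_, h0⟩ z
    simp only [ι]
    rw [this]
    simp [mul_comm]
  refine card_ker_compHom ι _ ?_ ?_
  · rw [injective_iff_map_eq_zero]
    intro x hx
    obtain ⟨z, rfl⟩ := ZMod.intCast_surjective x
    rw [hι, ZMod.intCast_zmod_eq_zero_iff_dvd] at hx
    rw [ZMod.intCast_zmod_eq_zero_iff_dvd]
    push_cast at hx ⊢
    rw [pow_succ'] at hx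
    exact (mul_dvd_mul_iff_left (by exact_mod_cast hp.ne_zero)).1 hx
  · ext x
    constructor
    · rintro ⟨y, rfl⟩
      obtain ⟨z, rfl⟩ := ZMod.intCast_surjective y
      rw [hι, AddMonoidHom.mem_ker]
      have := reduction_nsmul p hm (z : ZMod (p ^ (s + 1)))
      simpa using this
    · intro hx
      obtain ⟨y, rfl⟩ := exists_eq_nsmul_of_reduction_eq_zero hm hx
      obtain ⟨z, rfl⟩ := ZMod.intCast_surjective y
      exact ⟨z, by rw [hι]; simp⟩

theorem finite_addMonoidHom {A B : Type*} [AddCommGroup A] [AddCommGroup B] [Finite A] [Finite B] :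
    Finite (A →+ B) :=
  Finite.of_injective _ DFunLike.coe_injective

theorem surCard_pi_zmod {p : ℕ} (hp : p.Prime) {r : ℕ} {m : Fin r → ℕ} (hm : ∀ i, m i ≠ 0)
    (hanti : Antitone m) (A : Type) [AddCommGroup A] [Finite A] :
    surCard A (∀ i, ZMod (p ^ m i)) =
      ∏ i, (Nat.card (A →+ ZMod (p ^ m i)) -
        Nat.card (A →+ ZMod (p ^ (m i - 1))) * p ^ (i : ℕ)) := by
  have : Fact p.Prime := ⟨hp⟩
  have hne : ∀ n : ℕ, NeZero (p ^ n) := fun n => ⟨pow_ne_zero _ hp.ne_zero⟩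
  have : Finite (A →+ ZMod p) := finite_addMonoidHom
  have hfin : ∀ i, Finite (A →+ ZMod (p ^ m i)) := fun i => finite_addMonoidHom
  let e : {φ : A →+ ∀ i, ZMod (p ^ m i) // Function.Surjective φ} ≃
      {a : ∀ i, A →+ ZMod (p ^ m i) // LinearIndependent (ZMod p) fun i =>
        AddMonoidHom.compHom (reduction p (hm i)) (a i)} :=
    { toFun := fun φ => ⟨fun i => (Pi.evalAddMonoidHom _ i).comp φ.1,
        (surjective_iff_linearIndependent_reduction hm _).1 φ.2⟩
      invFun := fun a => ⟨AddMonoidHom.pi a.1,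
        (surjective_iff_linearIndependent_reduction hm _).2 a.2⟩
      left_inv := fun φ => rfl
      right_inv := fun a => rfl }
  rw [surCard, Nat.card_congr e, card_linearIndependent_apply]
  · simp_rw [card_ker_compHom_reduction hp]
  -- For i ≤ j the exponent m_j is at most m_i, so reduction mod p factors through ℤ/p^{m_j}ℤ: the
  -- images in Hom(A, 𝔽_p) increase with i, as the counting lemma needs.
  · rintro i j hij _ ⟨a, rfl⟩
    refine ⟨(ZMod.castHom (pow_dvd_pow p (hanti hij)) (ZMod (p ^ m j))).toAddMonoidHom.comp a, ?_⟩
    ext x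
    exact DFunLike.congr_fun (ZMod.castHom_comp (dvd_pow_self p (hm j))
      (pow_dvd_pow p (hanti hij))) (a x)

/-! ### Rows and columns of Young diagrams -/

theorem lt_rowLen_iff_lt_colLen (lam : YoungDiagram) (i j : ℕ) :
    j < lam.rowLen i ↔ i < lam.colLen j := by
  rw [← YoungDiagram.mem_iff_lt_rowLen, YoungDiagram.mem_iff_lt_colLen]

theorem colLen_eq_zero_iff (lam : YoungDiagram) (j : ℕ) :
    lam.colLen j = 0 ↔ lam.rowLen 0 ≤ j := by
  have := lt_rowLen_iff_lt_colLen lam 0 j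
  omega

theorem eq_of_colLen_eq {mu nu : YoungDiagram} (h : ∀ j, mu.colLen j = nu.colLen j) : mu = nu := by
  refine YoungDiagram.ext ?_
  ext ⟨i, j⟩
  rw [YoungDiagram.mem_cells, YoungDiagram.mem_cells, YoungDiagram.mem_iff_lt_colLen,
    YoungDiagram.mem_iff_lt_colLen, h]

theorem prod_rows_eq_prod_cols {M : Type*} [CommMonoid M] (lam : YoungDiagram) {N : ℕ}
    (hN : lam.rowLen 0 ≤ N) (g : ℕ → ℕ → M) :
    ∏ i ∈ Finset.range (lam.colLen 0), ∏ j ∈ Finset.range (lam.rowLen i), g i j =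
      ∏ j ∈ Finset.range N, ∏ i ∈ Finset.range (lam.colLen j), g i j := by
  refine Finset.prod_comm' fun i j => ?_
  simp only [Finset.mem_range]
  have h1 := lt_rowLen_iff_lt_colLen lam i j
  have h2 := lam.colLen_anti 0 j (Nat.zero_le j)
  have h3 := lam.rowLen_anti 0 i (Nat.zero_le i)
  omega

theorem sum_rows_eq_sum_cols {M : Type*} [AddCommMonoid M] (lam : YoungDiagram) {N : ℕ}
    (hN : lam.rowLen 0 ≤ N) (g : ℕ → ℕ → M) :
    ∑ i ∈ Finset.range (lam.colLen 0), ∑ j ∈ Finset.range (lam.rowLen i), g i j =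
      ∑ j ∈ Finset.range N, ∑ i ∈ Finset.range (lam.colLen j), g i j :=
  prod_rows_eq_prod_cols (M := Multiplicative M) lam hN g

/-- A product over the rows of a quantity depending on the last box of each row. -/
theorem prod_row_ends {M : Type*} [CommMonoid M] (lam : YoungDiagram) {N : ℕ}
    (hN : lam.rowLen 0 ≤ N) (g : ℕ → ℕ → M) :
    ∏ i ∈ Finset.range (lam.colLen 0), g i (lam.rowLen i - 1) =
      ∏ j ∈ Finset.range N, ∏ i ∈ Finset.Ico (lam.colLen (j + 1)) (lam.colLen j), g i j := by
  have h := Finset.prod_comm' (s := Finset.range (lam.colLen 0))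
    (t := fun i => {lam.rowLen i - 1}) (t' := Finset.range N)
    (s' := fun j => Finset.Ico (lam.colLen (j + 1)) (lam.colLen j)) (f := g) (fun i j => ?_)
  · simpa using h
  · simp only [Finset.mem_range, Finset.mem_singleton, Finset.mem_Ico]
    have h0 := lt_rowLen_iff_lt_colLen lam i 0
    have h1 := lt_rowLen_iff_lt_colLen lam i j
    have h4 := lt_rowLen_iff_lt_colLen lam i (j + 1)
    have h2 := lam.colLen_anti 0 j (Nat.zero_le j)
    have h3 := lam.rowLen_anti 0 i (Nat.zero_le i)
    omega

/-- Both sides count the boxes in the first m columns. -/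
theorem sum_min_rowLen (lam : YoungDiagram) (m : ℕ) :
    ∑ i ∈ Finset.range (lam.colLen 0), min m (lam.rowLen i) =
      ∑ j ∈ Finset.range m, lam.colLen j := by
  have h := Finset.sum_comm' (s := Finset.range (lam.colLen 0))
    (t := fun i => Finset.range (min m (lam.rowLen i))) (t' := Finset.range m)
    (s' := fun j => Finset.range (lam.colLen j)) (f := fun _ _ => 1) (fun i j => ?_)
  · simpa using h
  · simp only [Finset.mem_range]
    have h1 := lt_rowLen_iff_lt_colLen lam i j
    have h2 := lam.colLen_anti 0 j (Nat.zero_le j)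
    omega

theorem card_eq_sum_colLen (lam : YoungDiagram) {N : ℕ} (hN : lam.rowLen 0 ≤ N) :
    lam.card = ∑ j ∈ Finset.range N, lam.colLen j := by
  rw [YoungDiagram.card, Finset.card_eq_sum_card_fiberwise (f := Prod.snd) (t := Finset.range N)]
  · exact Finset.sum_congr rfl fun j _ => (lam.colLen_eq_card).symm
  · rintro ⟨i, j⟩ hc
    have h1 := YoungDiagram.mem_iff_lt_rowLen.1 ((YoungDiagram.mem_cells _).1 hc)
    have h3 := lam.rowLen_anti 0 i (Nat.zero_le i)
    simp only [Finset.coe_range, Set.mem_Iio]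
    omega

theorem nStat_eq_sum_colLen (lam : YoungDiagram) {N : ℕ} (hN : lam.rowLen 0 ≤ N) :
    nStat lam = ∑ j ∈ Finset.range N, ∑ i ∈ Finset.range (lam.colLen j), i := by
  rw [nStat, ← sum_rows_eq_sum_cols lam hN fun i _ => i]
  refine Finset.sum_congr rfl fun i _ => ?_
  simp [mul_comm]

/-- The Young diagram with column lengths `X 0, …, X (N - 1)`. -/
def ofColLens (X : ℕ → ℕ) (N : ℕ) : YoungDiagram where
  -- Bounding the row by X j for every j ≤ c.2, not just for c.2, gives a lower set even if X is not
  -- antitone.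
  cells := (Finset.range (X 0) ×ˢ Finset.range N).filter fun c => ∀ j ≤ c.2, c.1 < X j
  isLowerSet := by
    rintro ⟨i, j⟩ ⟨i', j'⟩ ⟨hi, hj⟩ h
    simp only [Finset.coe_filter, Finset.mem_product, Finset.mem_range, Set.mem_ofPred_eq] at hi hj h ⊢
    exact ⟨⟨hi.trans_lt h.1.1, hj.trans_lt h.1.2⟩,
      fun a ha => hi.trans_lt (h.2 a (ha.trans hj))⟩

theorem colLen_ofColLens {X : ℕ → ℕ} (hX : Antitone X) {N : ℕ} (hN : ∀ j, N ≤ j → X j = 0) (j : ℕ) :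
    (ofColLens X N).colLen j = X j := by
  refine eq_of_forall_lt_iff fun i => ?_
  rw [← YoungDiagram.mem_iff_lt_colLen, ← YoungDiagram.mem_cells]
  unfold ofColLens
  simp only [Finset.mem_filter, Finset.mem_product, Finset.mem_range]
  constructor
  · exact fun h => h.2 j le_rfl
  · intro h
    have h1 := hX (Nat.zero_le j)
    refine ⟨⟨by omega, ?_⟩, fun a ha => h.trans_le (hX ha)⟩
    by_contra hj
    have := hN j (not_lt.1 hj)
    omega

/-! ### Homomorphisms and surjections between the groups `G_{λ,p}` -/

theorem card_zmod_hom_zmod (a b : ℕ) [NeZero b] : Nat.card (ZMod a →+ ZMod b) = b.gcd a := by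
  rw [← Nat.card_zmod b, ← IsAddCyclic.card_nsmulAddMonoidHom_ker, Nat.card_zmod]
  refine Nat.card_congr (Equiv.ofBijective (fun f => ⟨f 1, ?_⟩) ⟨?_, ?_⟩)
  · rw [AddMonoidHom.mem_ker, nsmulAddMonoidHom_apply, ← map_nsmul]
    simp
  · intro f g hfg
    refine AddMonoidHom.ext fun x => ?_
    obtain ⟨z, rfl⟩ := ZMod.intCast_surjective x
    have : f 1 = g 1 := Subtype.ext_iff.1 hfg
    rw [← zsmul_one, map_zsmul, map_zsmul, this]
  · rintro ⟨y, hy⟩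
    have h0 : (zmultiplesHom (ZMod b) y) (a : ℤ) = 0 := by
      rw [AddMonoidHom.mem_ker, nsmulAddMonoidHom_apply] at hy
      simpa using hy
    refine ⟨ZMod.lift a ⟨_, h0⟩, Subtype.ext ?_⟩
    have := ZMod.lift_coe a ⟨_, h0⟩ 1
    simpa using this

theorem card_pGroup_hom_zmod {p : ℕ} (hp : p.Prime) (lam : YoungDiagram) (m : ℕ) :
    Nat.card (PGroup p lam →+ ZMod (p ^ m)) = p ^ ∑ j ∈ Finset.range m, lam.colLen j := by
  have hne : NeZero (p ^ m) := ⟨pow_ne_zero _ hp.ne_zero⟩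
  rw [Nat.card_congr (Pi.addMonoidHomAddEquiv (fun j : Fin (lam.colLen 0) =>
    ZMod (p ^ lam.rowLen j)) (ZMod (p ^ m))).toEquiv, Nat.card_pi, ← sum_min_rowLen,
    Finset.sum_range, ← Finset.prod_pow_eq_pow_sum]
  refine Finset.prod_congr rfl fun i _ => ?_
  rw [card_zmod_hom_zmod]
  rcases le_total m (lam.rowLen i) with h | h
  · rw [min_eq_left h, Nat.gcd_eq_left (pow_dvd_pow p h)]
  · rw [min_eq_right h, Nat.gcd_eq_right (pow_dvd_pow p h)]

theorem surCard_pGroup {p : ℕ} (hp : p.Prime) (lam mu : YoungDiagram) :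
    surCard (PGroup p lam) (PGroup p mu) =
      ∏ i ∈ Finset.range (mu.colLen 0), (p ^ (∑ j ∈ Finset.range (mu.rowLen i), lam.colLen j) -
        p ^ (∑ j ∈ Finset.range (mu.rowLen i - 1), lam.colLen j) * p ^ i) := by
  have hne : ∀ n : ℕ, NeZero (p ^ n) := fun n => ⟨pow_ne_zero _ hp.ne_zero⟩
  have hm : ∀ i : Fin (mu.colLen 0), mu.rowLen i ≠ 0 := fun i => by
    have := (lt_rowLen_iff_lt_colLen mu i 0).2 i.2
    omega
  rw [surCard_pi_zmod hp hm (fun i j hij => mu.rowLen_anti i j hij), Finset.prod_range]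
  simp_rw [card_pGroup_hom_zmod hp]

theorem surCard_pGroup_real {p : ℕ} (hp : p.Prime) (lam mu : YoungDiagram) :
    (surCard (PGroup p lam) (PGroup p mu) : ℝ) =
      (∏ i ∈ Finset.range (mu.colLen 0), ∏ j ∈ Finset.range (mu.rowLen i),
        (p : ℝ) ^ lam.colLen j) * ∏ i ∈ Finset.range (mu.colLen 0),
          (1 - (p : ℝ)⁻¹ ^ (lam.colLen (mu.rowLen i - 1) - i)) := by
  have hp0 : (p : ℝ) ≠ 0 := by exact_mod_cast hp.ne_zero
  rw [surCard_pGroup hp, Nat.cast_prod, ← Finset.prod_mul_distrib]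
  refine Finset.prod_congr rfl fun i hi => ?_
  obtain ⟨s, hs⟩ : ∃ s, mu.rowLen i = s + 1 := by
    have := (lt_rowLen_iff_lt_colLen mu i 0).2 (Finset.mem_range.1 hi)
    exact ⟨mu.rowLen i - 1, by omega⟩
  rw [hs, Nat.add_sub_cancel, Finset.prod_pow_eq_pow_sum, Finset.sum_range_succ, pow_add,
    ← Nat.mul_sub, Nat.cast_mul, Nat.cast_pow, pow_add, mul_assoc]
  congr 1
  rcases le_total i (lam.colLen s) with h | h
  · rw [Nat.cast_sub (Nat.pow_le_pow_right hp.pos h), mul_sub, mul_one, inv_pow, Nat.cast_pow,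
      Nat.cast_pow]
    congr 1
    rw [pow_sub₀ _ hp0 h, mul_inv, inv_inv, ← mul_assoc, mul_inv_cancel₀ (pow_ne_zero _ hp0),
      one_mul]
  · rw [Nat.sub_eq_zero_of_le (Nat.pow_le_pow_right hp.pos h), Nat.sub_eq_zero_of_le h]
    simp

/-- `1 / (t; t)_{l-x}`, which is `0` when `l < x`. -/
noncomputable def invPoch (t : ℝ) (l x : ℕ) : ℝ := if x ≤ l then (qPoch t t (l - x))⁻¹ else 0

theorem qPoch_zero (a q : ℝ) : qPoch a q 0 = 1 := by simp [qPoch]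

theorem qPoch_succ (t : ℝ) (n : ℕ) : qPoch t t (n + 1) = qPoch t t n * (1 - t ^ (n + 1)) := by
  rw [qPoch, Finset.prod_range_succ, ← qPoch, pow_succ']

theorem qPoch_ne_zero {t : ℝ} (h0 : 0 < t) (h1 : t < 1) (n : ℕ) : qPoch t t n ≠ 0 := by
  refine Finset.prod_ne_zero_iff.2 fun i _ => ?_
  rw [← pow_succ']
  have := pow_lt_one₀ h0.le h1 (Nat.succ_ne_zero i)
  exact (sub_pos.2 this).ne'

theorem prod_Ico_mul_qPoch (t : ℝ) {a b l : ℕ} (hab : a ≤ b) (hbl : b ≤ l) :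
    (∏ i ∈ Finset.Ico a b, (1 - t ^ (l - i))) * qPoch t t (l - b) = qPoch t t (l - a) := by
  induction b, hab using Nat.le_induction with
  | base => simp
  | succ b hab ih =>
    rw [← ih (by omega), Finset.prod_Ico_succ_top hab, mul_assoc]
    obtain ⟨s, rfl⟩ : ∃ s, l = b + 1 + s := ⟨l - (b + 1), by omega⟩
    have h1 : b + 1 + s - b = s + 1 := by omega
    have h2 : b + 1 + s - (b + 1) = s := by omega
    rw [h1, h2, qPoch_succ, mul_comm (qPoch t t s)]

/-- The number of surjections `G_{λ,p} → G_{μ,p}`, as a product over columns. -/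
theorem surCard_pGroup_eq_prod_cols {p : ℕ} (hp : p.Prime) (lam mu : YoungDiagram) {N : ℕ}
    (hN : mu.rowLen 0 ≤ N) :
    (surCard (PGroup p lam) (PGroup p mu) : ℝ) =
      ∏ j ∈ Finset.range N, ((p : ℝ) ^ (lam.colLen j * mu.colLen j) *
        (qPoch (p : ℝ)⁻¹ (p : ℝ)⁻¹ (lam.colLen j - mu.colLen (j + 1)) *
          invPoch (p : ℝ)⁻¹ (lam.colLen j) (mu.colLen j))) := by
  have ht0 : 0 < (p : ℝ)⁻¹ := inv_pos.2 (by exact_mod_cast hp.pos)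
  have ht1 : (p : ℝ)⁻¹ < 1 := inv_lt_one_of_one_lt₀ (by exact_mod_cast hp.one_lt)
  rw [surCard_pGroup_real hp]
  by_cases h : ∀ j, mu.colLen j ≤ lam.colLen j
  · rw [prod_rows_eq_prod_cols mu hN fun _ j => (p : ℝ) ^ lam.colLen j,
      prod_row_ends mu hN fun i j => 1 - (p : ℝ)⁻¹ ^ (lam.colLen j - i), ← Finset.prod_mul_distrib]
    refine Finset.prod_congr rfl fun j _ => ?_
    rw [Finset.prod_const, Finset.card_range, ← pow_mul, invPoch, if_pos (h j),
      ← prod_Ico_mul_qPoch _ (mu.colLen_anti j (j + 1) (Nat.le_succ j)) (h j),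
      mul_inv_cancel_right₀ (qPoch_ne_zero ht0 ht1 _)]
  -- If μ_j' > λ_j', row i = λ_j' of μ ends in column j or later, where λ has at most i boxes; its
  -- factor is 0, matching the convention in `invPoch`.
  · push Not at h
    obtain ⟨j, hj⟩ := h
    have h1 := (lt_rowLen_iff_lt_colLen mu (lam.colLen j) j).2 hj
    have h2 := mu.colLen_anti 0 j (Nat.zero_le j)
    have h3 := mu.rowLen_anti 0 (lam.colLen j) (Nat.zero_le _)
    have h4 := lam.colLen_anti j (mu.rowLen (lam.colLen j) - 1) (by omega)
    have h5 : ∏ i ∈ Finset.range (mu.colLen 0),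
        (1 - (p : ℝ)⁻¹ ^ (lam.colLen (mu.rowLen i - 1) - i)) = 0 :=
      Finset.prod_eq_zero (i := lam.colLen j) (Finset.mem_range.2 (hj.trans_le h2))
        (by rw [Nat.sub_eq_zero_of_le h4, pow_zero, sub_self])
    rw [h5, mul_zero, Finset.prod_eq_zero (i := j) (Finset.mem_range.2 (by omega))]
    rw [invPoch, if_neg (not_le.2 hj), mul_zero, mul_zero]

/-! ### The alternating `q`-binomial sum -/

/-- A closed form for the partial sums of the alternating q-binomial sum of order L = k + r + 1. The
induction raises k while lowering r, keeping L fixed. -/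
theorem sum_range_alternating {t : ℝ} (ht0 : 0 < t) (ht1 : t < 1) (k r : ℕ) :
    ∑ s ∈ Finset.range (k + 1), (-1 : ℝ) ^ s * t ^ (∑ i ∈ Finset.range (s + 1), i) *
        t⁻¹ ^ ((k + r + 1) * s) / (qPoch t t s * qPoch t t (k + r + 1 - s)) =
      (-1 : ℝ) ^ k * t ^ (∑ i ∈ Finset.range (k + 1), i) * t⁻¹ ^ ((k + r + 1) * k) /
        (qPoch t t k * qPoch t t r * (1 - t ^ (k + r + 1))) := by
  induction k generalizing r with
  | zero =>
    simp only [zero_add, Finset.range_one, Finset.sum_singleton, pow_zero, mul_zero, mul_one,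
      qPoch_zero, one_mul, Nat.sub_zero]
    rw [qPoch_succ]
  | succ k ih =>
    have h := ih (r + 1)
    have e1 : k + (r + 1) + 1 = k + 1 + r + 1 := by ring
    have hP := qPoch_ne_zero ht0 ht1
    have hpow : ∀ n : ℕ, 1 - t ^ (n + 1) ≠ 0 := fun n =>
      (sub_pos.2 (pow_lt_one₀ ht0.le ht1 (Nat.succ_ne_zero n))).ne'
    rw [e1] at h
    rw [Finset.sum_range_succ, h, show k + 1 + r + 1 - (k + 1) = r + 1 by omega]
    have e2 : (t : ℝ)⁻¹ ^ ((k + 1 + r + 1) * (k + 1)) =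
        t⁻¹ ^ ((k + 1 + r + 1) * k) * (t⁻¹ ^ (k + 1) * t⁻¹ ^ (r + 1)) := by
      rw [← pow_add, ← pow_add]; congr 1
    have e3 : t ^ (k + 1 + r + 1) = t ^ (k + 1) * t ^ (r + 1) := by rw [← pow_add]; congr 1
    rw [Finset.sum_range_succ _ (k + 1), pow_add t _ (k + 1), e2, pow_succ (-1 : ℝ),
      qPoch_succ t k, qPoch_succ t r, inv_pow t (k + 1), inv_pow t (r + 1)]
    have h1 := hP k
    have h2 := hP r
    have h3 := hpow k
    have h4 := hpow r
    have h5 := hpow (k + 1 + r)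
    have h6 : t ^ (k + 1) ≠ 0 := (pow_pos ht0 _).ne'
    have h7 : t ^ (r + 1) ≠ 0 := (pow_pos ht0 _).ne'
    rw [e3] at h5 ⊢
    generalize t⁻¹ ^ ((k + 1 + r + 1) * k) = u
    generalize t ^ (∑ i ∈ Finset.range (k + 1), i) = v
    generalize (-1 : ℝ) ^ k = w
    generalize t ^ (k + 1) = x at *
    generalize t ^ (r + 1) = y at *
    have h8 : 1 - y * x ≠ 0 := by rwa [mul_comm]
    field_simp
    ring

theorem sum_alternating_eq_zero {t : ℝ} (ht0 : 0 < t) (ht1 : t < 1) {L : ℕ} (hL : L ≠ 0) :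
    ∑ s ∈ Finset.range (L + 1), (-1 : ℝ) ^ s * t ^ (∑ i ∈ Finset.range (s + 1), i) *
        t⁻¹ ^ (L * s) / (qPoch t t s * qPoch t t (L - s)) = 0 := by
  obtain ⟨k, rfl⟩ := Nat.exists_eq_succ_of_ne_zero hL
  have h := sum_range_alternating ht0 ht1 k 0
  simp only [add_zero, qPoch_zero, mul_one] at h
  -- The partial sum up to L - 1 cancels the last term.
  rw [Finset.sum_range_succ, Nat.succ_eq_add_one, h, Nat.sub_self, qPoch_zero,
    Finset.sum_range_succ _ (k + 1), qPoch_succ]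
  have h1 := qPoch_ne_zero ht0 ht1 k
  have h3 : 1 - t ^ (k + 1) ≠ 0 := (sub_pos.2 (pow_lt_one₀ ht0.le ht1 (Nat.succ_ne_zero k))).ne'
  have h6 : t ^ (k + 1) ≠ 0 := (pow_pos ht0 _).ne'
  have e2 : (t : ℝ)⁻¹ ^ ((k + 1) * (k + 1)) = t⁻¹ ^ ((k + 1) * k) * t⁻¹ ^ (k + 1) := by
    rw [← pow_add]; congr 1
  rw [e2, pow_add, pow_succ (-1 : ℝ), inv_pow t (k + 1)]
  field_simp
  ring

/-! ### Orthogonality for a single prime -/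

/-- The factor of `invCoeff p nu mu * surCard (PGroup p lam) (PGroup p mu)` that depends on the
length `x` of one column of `mu`; `l`, `n` are the lengths of the same column in `lam` and `nu`,
and `l'`, `n'` those of the preceding column. -/
noncomputable def colTerm (t : ℝ) (l' n' l n x : ℕ) : ℝ :=
  (-1 : ℝ) ^ (x - n) * t ^ (∑ i ∈ Finset.range n, i + ∑ i ∈ Finset.range (x + 1), i) *
    t⁻¹ ^ (l * x) * invPoch t l x / qPoch t t (x - n) *
      (qPoch t t (l' - x) / qPoch t t (n' - x))

theorem sum_colTerm_eq_one {t : ℝ} (ht0 : 0 < t) (ht1 : t < 1) {l l' : ℕ} (h : l ≤ l') :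
    ∑ x ∈ Finset.Icc l l', colTerm t l' l' l l x = 1 := by
  rw [Finset.sum_eq_single_of_mem l (Finset.left_mem_Icc.2 h)]
  · rw [colTerm, div_self (qPoch_ne_zero ht0 ht1 _), invPoch, if_pos le_rfl, Nat.sub_self,
      qPoch_zero]
    have e1 : ∑ i ∈ Finset.range l, i + ∑ i ∈ Finset.range (l + 1), i = l * l := by
      have a1 := Finset.sum_range_id_mul_two (l + 1)
      rw [Finset.sum_range_succ] at a1 ⊢
      simp only [Nat.add_sub_cancel] at a1
      linarith
    rw [e1, pow_zero, one_mul, ← mul_pow, mul_inv_cancel₀ ht0.ne']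
    simp
  · intro x hx hne
    have := (Finset.mem_Icc.1 hx).1
    rw [colTerm, invPoch, if_neg (by omega)]
    simp

theorem sum_colTerm_eq_zero_of_lt {t : ℝ} {l' n' l n : ℕ} (h : l < n) :
    ∑ x ∈ Finset.Icc n n', colTerm t l' n' l n x = 0 := by
  refine Finset.sum_eq_zero fun x hx => ?_
  have := (Finset.mem_Icc.1 hx).1
  rw [colTerm, invPoch, if_neg (by omega)]
  simp

/-- With equal preceding columns the ratio of the two symbols in l' is 1. Terms with x > l vanish,
and x = n + s turns the rest into a multiple of the alternating sum of order L = l - n. -/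
theorem sum_colTerm_eq_zero_of_gt {t : ℝ} (ht0 : 0 < t) (ht1 : t < 1) {l' l n : ℕ} (h : n < l)
    (hl : l ≤ l') : ∑ x ∈ Finset.Icc n l', colTerm t l' l' l n x = 0 := by
  obtain ⟨L, rfl⟩ : ∃ L, l = n + L := ⟨l - n, by omega⟩
  have hsub : (Finset.range (L + 1)).map (addLeftEmbedding n) ⊆ Finset.Icc n l' := by
    intro x hx
    obtain ⟨s, hs, rfl⟩ := Finset.mem_map.1 hx
    have := Finset.mem_range.1 hs
    simp only [addLeftEmbedding_apply, Finset.mem_Icc]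
    omega
  rw [← Finset.sum_subset hsub, Finset.sum_map]
  · have key := sum_alternating_eq_zero ht0 ht1 (L := L) (by omega)
    have := congrArg (fun z => t ^ (∑ i ∈ Finset.range n, i + ∑ i ∈ Finset.range (n + 1), i) *
      t⁻¹ ^ ((n + L) * n) * z) key
    simp only [mul_zero, Finset.mul_sum] at this
    rw [← this]
    refine Finset.sum_congr rfl fun s hs => ?_
    have hs' : s ≤ L := Nat.lt_succ_iff.1 (Finset.mem_range.1 hs)
    rw [colTerm, addLeftEmbedding_apply, div_self (qPoch_ne_zero ht0 ht1 _), invPoch,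
      if_pos (by omega), Nat.add_sub_cancel_left, Nat.add_sub_add_left]
    have e1 : ∑ i ∈ Finset.range (n + s + 1), i =
        ∑ i ∈ Finset.range (n + 1), i + ∑ i ∈ Finset.range (s + 1), i + n * s := by
      have a1 := Finset.sum_range_id_mul_two (n + s + 1)
      have a2 := Finset.sum_range_id_mul_two (n + 1)
      have a3 := Finset.sum_range_id_mul_two (s + 1)
      simp only [Nat.add_sub_cancel] at a1 a2 a3
      nlinarith
    have e2 : (n + L) * (n + s) = (n + L) * n + L * s + n * s := by ring
    -- The cross term ns in binom(n+s+1, 2) cancels the one in l·x, leaving t^{-Ls}.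
    have e3 : t ^ (n * s) * t⁻¹ ^ (n * s) = 1 := by
      rw [← mul_pow, mul_inv_cancel₀ ht0.ne', one_pow]
    rw [e1, e2, pow_add, pow_add, pow_add, pow_add, pow_add, pow_add]
    linear_combination ((-1) ^ s * t ^ (∑ i ∈ Finset.range n, i) *
      t ^ (∑ i ∈ Finset.range (n + 1), i) * t ^ (∑ i ∈ Finset.range (s + 1), i) *
      t⁻¹ ^ ((n + L) * n) * t⁻¹ ^ (L * s) * (qPoch t t (L - s))⁻¹ / qPoch t t s) * e3
  · intro x hx hx'
    have h1 := (Finset.mem_Icc.1 hx).1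
    have h2 : ¬ x ≤ n + L := by
      intro hle
      exact hx' (Finset.mem_map.2 ⟨x - n, Finset.mem_range.2 (by omega), by
        simp only [addLeftEmbedding_apply]; omega⟩)
    rw [colTerm, invPoch, if_neg h2]
    simp

/-- The sequence `B, f 0, f 1, …`. -/
def prepend (B : ℕ) (f : ℕ → ℕ) : ℕ → ℕ
  | 0 => B
  | j + 1 => f j

/-- Interlacing lets μ have at most one column more than ν, hence the products over N + 1 columns
below. -/
theorem ConjInterlaces.rowLen_le {mu nu : YoungDiagram} (h : ConjInterlaces mu nu) :
    mu.rowLen 0 ≤ nu.rowLen 0 + 1 := by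
  rw [← colLen_eq_zero_iff]
  have := (h (nu.rowLen 0)).2
  rw [(colLen_eq_zero_iff nu _).2 le_rfl] at this
  omega

theorem invCoeff_eq_prod_cols {p : ℕ} {mu nu : YoungDiagram}
    (h : ConjInterlaces mu nu) {N : ℕ} (hN : nu.rowLen 0 + 1 ≤ N) :
    invCoeff p nu mu = ∏ j ∈ Finset.range N, ((-1 : ℝ) ^ (mu.colLen j - nu.colLen j) *
      (p : ℝ)⁻¹ ^ (∑ i ∈ Finset.range (nu.colLen j), i +
        ∑ i ∈ Finset.range (mu.colLen j + 1), i) /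
      (qPoch (p : ℝ)⁻¹ (p : ℝ)⁻¹ (mu.colLen j - nu.colLen j) *
        qPoch (p : ℝ)⁻¹ (p : ℝ)⁻¹ (nu.colLen j - mu.colLen (j + 1)))) := by
  have hmu : mu.rowLen 0 ≤ N := h.rowLen_le.trans hN
  have hnu : nu.rowLen 0 ≤ N := by omega
  have h1 : (mu.card : ℤ) - (nu.card : ℤ) =
      ((∑ j ∈ Finset.range N, (mu.colLen j - nu.colLen j) : ℕ) : ℤ) := by
    rw [card_eq_sum_colLen mu hmu, card_eq_sum_colLen nu hnu]
    push_cast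
    rw [← Finset.sum_sub_distrib]
    exact Finset.sum_congr rfl fun j _ => (Nat.cast_sub (h j).1).symm
  have h2 : -(nStat nu : ℤ) - (nStat mu : ℤ) - (mu.card : ℤ) =
      -((∑ j ∈ Finset.range N, (∑ i ∈ Finset.range (nu.colLen j), i +
        ∑ i ∈ Finset.range (mu.colLen j + 1), i) : ℕ) : ℤ) := by
    rw [card_eq_sum_colLen mu hmu, nStat_eq_sum_colLen mu hmu, nStat_eq_sum_colLen nu hnu]
    simp only [Finset.sum_range_succ _ (mu.colLen _)]
    rw [Finset.sum_add_distrib, Finset.sum_add_distrib]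
    push_cast
    ring
  rw [Finset.prod_div_distrib, Finset.prod_mul_distrib, Finset.prod_pow_eq_pow_sum,
    Finset.prod_pow_eq_pow_sum, invCoeff, h1, h2, zpow_natCast, zpow_neg, zpow_natCast, ← inv_pow]
  congr 1
  refine finprod_eq_prod_of_mulSupport_subset _ fun j hj => ?_
  by_contra hjN
  have hjN' : N ≤ j := by simpa using hjN
  refine hj ?_
  have a1 := (colLen_eq_zero_iff mu j).2 (hmu.trans hjN')
  have a2 := (colLen_eq_zero_iff nu j).2 (hnu.trans hjN')
  simp only [a1, a2, Nat.zero_sub, qPoch_zero, mul_one]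

theorem invCoeff_mul_surCard {p : ℕ} (hp : p.Prime) {lam mu nu : YoungDiagram}
    (h : ConjInterlaces mu nu) {N : ℕ} (hN : nu.rowLen 0 ≤ N) (hN' : lam.rowLen 0 ≤ N) (B : ℕ) :
    invCoeff p nu mu * surCard (PGroup p lam) (PGroup p mu) =
      ∏ j ∈ Finset.range (N + 1), colTerm (p : ℝ)⁻¹ (prepend B lam.colLen j)
        (prepend B nu.colLen j) (lam.colLen j) (nu.colLen j) (mu.colLen j) := by
  have ht0 : 0 < (p : ℝ)⁻¹ := inv_pos.2 (by exact_mod_cast hp.pos)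
  have ht1 : (p : ℝ)⁻¹ < 1 := inv_lt_one_of_one_lt₀ (by exact_mod_cast hp.one_lt)
  have hP := qPoch_ne_zero ht0 ht1
  rw [invCoeff_eq_prod_cols h (Nat.succ_le_succ hN),
    surCard_pGroup_eq_prod_cols hp lam mu (h.rowLen_le.trans (Nat.succ_le_succ hN)),
    ← Finset.prod_mul_distrib]
  have hl : lam.colLen N = 0 := (colLen_eq_zero_iff lam N).2 hN'
  have hn : nu.colLen N = 0 := (colLen_eq_zero_iff nu N).2 hN
  let f : ℕ → ℝ := fun j =>
    qPoch (p : ℝ)⁻¹ (p : ℝ)⁻¹ (prepend B lam.colLen j - mu.colLen j) /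
      qPoch (p : ℝ)⁻¹ (p : ℝ)⁻¹ (prepend B nu.colLen j - mu.colLen j)
  -- The ratio (t;t)_{λ_j' - μ_{j+1}'} / (t;t)_{ν_j' - μ_{j+1}'} moves from column j to column j +
  -- 1, where it depends on the same column of μ as the other factors. The ends contribute 1: the
  -- fictitious column before the first has length B for both partitions, and column N is empty in
  -- both.
  have hshift : ∏ j ∈ Finset.range (N + 1), f (j + 1) = ∏ j ∈ Finset.range (N + 1), f j := by
    have h0 : f 0 = 1 := div_self (hP _)
    have h1 : f (N + 1) = 1 := by
      simp only [f, prepend, hl, hn]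
      exact div_self (hP _)
    rw [Finset.prod_range_succ' f N, h0, Finset.prod_range_succ, h1]
  simp only [colTerm]
  rw [Finset.prod_mul_distrib (g := f), ← hshift, ← Finset.prod_mul_distrib]
  refine Finset.prod_congr rfl fun j _ => ?_
  simp only [f, prepend, inv_inv]
  rw [div_mul_eq_mul_div, mul_comm (qPoch _ _ (mu.colLen j - nu.colLen j)), ← div_div]
  ring

open Classical in
/-- The inversion coefficient for a single prime, extended by `0` to all pairs of partitions. -/
noncomputable def invCoeffExt (p : ℕ) (nu mu : YoungDiagram) : ℝ :=
  if ConjInterlaces mu nu then invCoeff p nu mu else 0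

open Classical in
/-- The inversion coefficients are orthogonal to the numbers of surjections. -/
theorem exists_sum_invCoeffExt_mul_surCard {p : ℕ} (hp : p.Prime) (lam nu : YoungDiagram) :
    ∃ T : Finset YoungDiagram,
      (∀ mu ∉ T, invCoeffExt p nu mu * surCard (PGroup p lam) (PGroup p mu) = 0) ∧
      ∑ mu ∈ T, invCoeffExt p nu mu * surCard (PGroup p lam) (PGroup p mu) =
        if lam = nu then 1 else 0 := by
  classical
  have ht0 : 0 < (p : ℝ)⁻¹ := inv_pos.2 (by exact_mod_cast hp.pos)
  have ht1 : (p : ℝ)⁻¹ < 1 := inv_lt_one_of_one_lt₀ (by exact_mod_cast hp.one_lt)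
  obtain ⟨N, hNn, hNl⟩ : ∃ N, nu.rowLen 0 ≤ N ∧ lam.rowLen 0 ≤ N :=
    ⟨_, le_max_left _ _, le_max_right _ _⟩
  -- Interlacing does not bound the first column of μ from above. Any cap that is at least both
  -- first columns serves, since terms with μ_1' > λ_1' vanish.
  let B := nu.colLen 0 + lam.colLen 0
  let ext (x : Fin (N + 1) → ℕ) (j : ℕ) : ℕ := if h : j < N + 1 then x ⟨j, h⟩ else 0
  have hext (x : Fin (N + 1) → ℕ) (j : Fin (N + 1)) : ext x j = x j := dif_pos j.2
  let box : Finset (Fin (N + 1) → ℕ) :=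
    Fintype.piFinset fun j => Finset.Icc (nu.colLen j) (prepend B nu.colLen j)
  have hcol0 : ∀ j, N ≤ j → nu.colLen j = 0 := fun j hj => (colLen_eq_zero_iff nu j).2 (hNn.trans hj)
  have hbox : ∀ x ∈ box, ∀ j, nu.colLen j ≤ ext x j ∧ ext x (j + 1) ≤ nu.colLen j := by
    intro x hx j
    rw [Fintype.mem_piFinset] at hx
    constructor
    · by_cases h : j < N + 1
      · simp only [ext, dif_pos h]
        exact (Finset.mem_Icc.1 (hx ⟨j, h⟩)).1
      · rw [hcol0 j (by omega)]
        exact Nat.zero_le _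
    · by_cases h : j + 1 < N + 1
      · simp only [ext, dif_pos h]
        exact (Finset.mem_Icc.1 (hx ⟨j + 1, h⟩)).2
      · simp only [ext, dif_neg h]
        exact Nat.zero_le _
  have hcol : ∀ x ∈ box, ∀ j, (ofColLens (ext x) (N + 1)).colLen j = ext x j := by
    intro x hx
    refine colLen_ofColLens (antitone_nat_of_succ_le fun j => ?_) fun j hj => dif_neg (by omega)
    exact (hbox x hx j).2.trans (hbox x hx j).1
  have hint : ∀ x ∈ box, ConjInterlaces (ofColLens (ext x) (N + 1)) nu := by
    intro x hx j
    rw [hcol x hx, hcol x hx]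
    exact hbox x hx j
  refine ⟨box.image fun x => ofColLens (ext x) (N + 1), ?_, ?_⟩
  · intro mu hmu
    by_cases h : ConjInterlaces mu nu
    swap
    · rw [invCoeffExt, if_neg h, zero_mul]
    rw [invCoeffExt, if_pos h, invCoeff_mul_surCard hp h hNn hNl B]
    have hB : B < mu.colLen 0 := by
      by_contra hB
      refine hmu (Finset.mem_image.2 ⟨fun j => mu.colLen j, ?_, ?_⟩)
      · rw [Fintype.mem_piFinset]
        rintro ⟨j, hj⟩
        refine Finset.mem_Icc.2 ⟨(h j).1, ?_⟩
        cases j with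
        | zero => exact not_lt.1 hB
        | succ j => exact (h j).2
      · have hext : ext (fun j => mu.colLen j) = mu.colLen := by
          funext j
          by_cases hj : j < N + 1
          · simp only [ext, dif_pos hj]
          · simp only [ext, dif_neg hj]
            exact ((colLen_eq_zero_iff mu j).2 (by have := h.rowLen_le; omega)).symm
        rw [hext]
        refine eq_of_colLen_eq fun j => colLen_ofColLens (fun a b => mu.colLen_anti a b)
          (fun j hj => (colLen_eq_zero_iff mu j).2 (by have := h.rowLen_le; omega)) j
    refine Finset.prod_eq_zero (i := 0) (by simp) ?_
    have : lam.colLen 0 ≤ B := Nat.le_add_left _ _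
    rw [colTerm, invPoch, if_neg (by omega)]
    simp
  · rw [Finset.sum_image]
    swap
    · intro x hx y hy hxy
      funext j
      have h1 := hcol x hx j
      simp only at hxy
      rw [hxy, hcol y hy j] at h1
      rw [← hext x, ← hext y, h1]
    have h1 : ∀ x ∈ box, invCoeffExt p nu (ofColLens (ext x) (N + 1)) *
        surCard (PGroup p lam) (PGroup p (ofColLens (ext x) (N + 1))) =
        ∏ j : Fin (N + 1), colTerm (p : ℝ)⁻¹ (prepend B lam.colLen j)
          (prepend B nu.colLen j) (lam.colLen j) (nu.colLen j) (x j) := by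
      intro x hx
      rw [invCoeffExt, if_pos (hint x hx), invCoeff_mul_surCard hp (hint x hx) hNn hNl B,
        Finset.prod_range]
      refine Finset.prod_congr rfl fun j _ => ?_
      rw [hcol x hx, hext]
    rw [Finset.sum_congr rfl h1, ← Finset.prod_univ_sum]
    have hle : ∀ j, lam.colLen j ≤ prepend B lam.colLen j := by
      intro j
      cases j with
      | zero => exact Nat.le_add_left _ _
      | succ j => exact lam.colLen_anti j (j + 1) (Nat.le_succ j)
    by_cases heq : lam = nu
    · subst heq
      rw [if_pos rfl]
      exact Finset.prod_eq_one fun j _ => sum_colTerm_eq_one ht0 ht1 (hle j)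
    · rw [if_neg heq]
      -- At the first differing column the preceding columns agree, so the one-variable sum there is
      -- 0.
      have hex : ∃ j, lam.colLen j ≠ nu.colLen j := by
        by_contra hall
        push Not at hall
        exact heq (eq_of_colLen_eq hall)
      have hj := Nat.find_spec hex
      have hmin : ∀ i, i < Nat.find hex → lam.colLen i = nu.colLen i := fun i hi =>
        not_not.1 (Nat.find_min hex hi)
      generalize Nat.find hex = j at hj hmin
      have hjN : j < N + 1 := by
        by_contra hjN
        rw [hcol0 j (by omega), (colLen_eq_zero_iff lam j).2 (by omega)] at hj
        exact hj rfl
      refine Finset.prod_eq_zero (Finset.mem_univ ⟨j, hjN⟩) ?_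
      have hpre : prepend B nu.colLen j = prepend B lam.colLen j := by
        cases j with
        | zero => rfl
        | succ j => exact (hmin j (Nat.lt_succ_self j)).symm
      rcases lt_or_gt_of_ne hj with h | h
      · exact sum_colTerm_eq_zero_of_lt h
      · simp only [hpre]
        exact sum_colTerm_eq_zero_of_gt ht0 ht1 h (hle j)

/-! ### Products over distinct primes -/

/-- Without homomorphisms between different indices every φ is diagonal. -/
theorem surCard_pi {k : ℕ} {A B : Fin k → Type} [∀ i, AddCommGroup (A i)]
    [∀ i, AddCommGroup (B i)] (hcross : ∀ i j, i ≠ j → ∀ f : A i →+ B j, f = 0) :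
    surCard (∀ i, A i) (∀ i, B i) = ∏ i, surCard (A i) (B i) := by
  have key (φ : (∀ i, A i) →+ ∀ i, B i) (x : ∀ i, A i) (j : Fin k) :
      φ x j = φ (Pi.single j (x j)) j := by
    conv_lhs => rw [← Finset.univ_sum_single x, map_sum, Finset.sum_apply]
    refine Finset.sum_eq_single_of_mem j (Finset.mem_univ j) fun i _ hij => ?_
    exact DFunLike.congr_fun (hcross i j hij
      ((Pi.evalAddMonoidHom B j).comp (φ.comp (AddMonoidHom.single A i)))) (x i)
  let e : {φ : (∀ i, A i) →+ ∀ i, B i // Function.Surjective φ} ≃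
      ∀ i, {f : A i →+ B i // Function.Surjective f} :=
    { toFun := fun φ i => ⟨(Pi.evalAddMonoidHom B i).comp (φ.1.comp (AddMonoidHom.single A i)),
        fun y => by
          obtain ⟨x, hx⟩ := φ.2 (Pi.single i y)
          refine ⟨x i, ?_⟩
          have := key φ.1 x i
          rw [hx, Pi.single_eq_same] at this
          exact this.symm⟩
      invFun := fun f => ⟨AddMonoidHom.pi fun i => (f i).1.comp (Pi.evalAddMonoidHom A i),
        fun y => by
          choose x hx using fun i => (f i).2 (y i)
          exact ⟨x, funext hx⟩⟩
      left_inv := fun φ => by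
        refine Subtype.ext (AddMonoidHom.ext fun x => funext fun j => ?_)
        exact (key φ.1 x j).symm
      right_inv := fun f => by
        refine funext fun i => Subtype.ext (AddMonoidHom.ext fun x => ?_)
        change (f i).1 (Pi.single i x i) = (f i).1 x
        rw [Pi.single_eq_same] }
  rw [surCard, Nat.card_congr e, Nat.card_pi]
  rfl

theorem pow_rowLen_nsmul (p : ℕ) (lam : YoungDiagram) (x : PGroup p lam) :
    p ^ lam.rowLen 0 • x = 0 := by
  funext j
  have h0 : ((p ^ lam.rowLen 0 : ℕ) : ZMod (p ^ lam.rowLen j)) = 0 :=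
    (ZMod.natCast_eq_zero_iff _ _).2 (pow_dvd_pow _ (lam.rowLen_anti 0 j (Nat.zero_le _)))
  rw [Pi.smul_apply, nsmul_eq_mul, h0, zero_mul, Pi.zero_apply]

theorem pGroup_hom_eq_zero {p q : ℕ} (hp : p.Prime) (hq : q.Prime) (hpq : p ≠ q)
    (lam mu : YoungDiagram) (f : PGroup p lam →+ PGroup q mu) : f = 0 := by
  refine AddMonoidHom.ext fun x => ?_
  have h1 : p ^ lam.rowLen 0 • f x = 0 := by rw [← map_nsmul, pow_rowLen_nsmul, map_zero]
  have h2 := pow_rowLen_nsmul q mu (f x)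
  have h3 := Nat.Coprime.pow (lam.rowLen 0) (mu.rowLen 0) ((Nat.coprime_primes hp hq).2 hpq)
  exact AddMonoid.addOrderOf_eq_one_iff.1 (Nat.eq_one_of_dvd_coprimes h3
    (addOrderOf_dvd_of_nsmul_eq_zero h1) (addOrderOf_dvd_of_nsmul_eq_zero h2))

theorem sur_stdGroup {k : ℕ} {p : Fin k → ℕ} (hp : ∀ i, (p i).Prime)
    (hinj : Function.Injective p) (lam mu : Fin k → YoungDiagram) :
    sur (stdGroup p hp lam) (stdGroup p hp mu) =
      ∏ i, surCard (PGroup (p i) (lam i)) (PGroup (p i) (mu i)) :=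
  surCard_pi fun i j hij f => pGroup_hom_eq_zero (hp i) (hp j) (hinj.ne hij) _ _ f

/-! ### Every group is isomorphic to some `G_{λ(1),…,λ(k)}(P)` -/

theorem exists_youngDiagram_rowLen {S : Type*} [Fintype S] (e : S → ℕ) (he : ∀ s, e s ≠ 0) :
    ∃ (lam : YoungDiagram) (σ : Fin (lam.colLen 0) ≃ S),
      ∀ j : Fin (lam.colLen 0), lam.rowLen j = e (σ j) := by
  let n := Fintype.card S
  let τ : Fin n ≃ S := (Fintype.equivFin S).symm
  -- The sort is increasing, so it is reversed to list the parts in decreasing order.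
  let ρ : Fin n ≃ S := (Fin.revPerm.trans (Tuple.sort (e ∘ τ))).trans τ
  have hanti : Antitone (e ∘ ρ) := fun i j hij =>
    Tuple.monotone_sort (e ∘ τ) (Fin.rev_le_rev.2 hij)
  let lam := YoungDiagram.ofRowLens (List.ofFn (e ∘ ρ)) (List.sortedGE_ofFn_iff.2 hanti)
  have hlen : lam.colLen 0 = n := by
    rw [← YoungDiagram.length_rowLens, YoungDiagram.rowLens_length_ofRowLens, List.length_ofFn]
    intro x hx
    obtain ⟨i, rfl⟩ := List.mem_ofFn.1 hx
    exact Nat.pos_of_ne_zero (he _)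
  refine ⟨lam, (finCongr hlen).trans ρ, fun j => ?_⟩
  have h := YoungDiagram.rowLen_ofRowLens (w := List.ofFn (e ∘ ρ))
    (hw := List.sortedGE_ofFn_iff.2 hanti) ⟨j, by rw [List.length_ofFn, ← hlen]; exact j.2⟩
  refine h.trans ?_
  simp
  rfl

theorem stdGroup_surjective {k : ℕ} (p : Fin k → ℕ) (hp : ∀ i, (p i).Prime)
    (hinj : Function.Injective p) : Function.Surjective (stdGroup p hp) := by
  classical
  intro H
  induction H using Quotient.inductionOn with
  | _ C =>
  obtain ⟨ι, _, q, hq, e, ⟨E⟩⟩ := AddCommGroup.equiv_directSum_zmod_of_finite C.carrier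
  have hmem : ∀ x, e x ≠ 0 → ∃ i, p i = q x := by
    intro x hx
    refine C.prime_mem (q x) (hq x) ?_
    rw [Nat.card_congr (E.trans (DirectSum.addEquivProd _)).toEquiv, Nat.card_pi]
    simp only [Nat.card_zmod]
    exact (dvd_pow_self _ hx).trans (Finset.dvd_prod_of_mem _ (Finset.mem_univ x))
  choose lam σ hσ using fun i : Fin k => exists_youngDiagram_rowLen
    (S := {x : ι // e x ≠ 0 ∧ p i = q x}) (fun x => e x) (fun x => x.2.1)
  let c (i : Fin k) (j : Fin ((lam i).colLen 0)) :
      ZMod (q (σ i j) ^ e (σ i j)) ≃+ ZMod (p i ^ (lam i).rowLen j) :=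
    (ZMod.ringEquivCongr (by rw [← (σ i j).2.2, hσ])).toAddEquiv
  have hσinj : ∀ i j i' j', ((σ i j : ι) = σ i' j') → (⟨i, j⟩ : Σ i, Fin ((lam i).colLen 0)) =
      ⟨i', j'⟩ := by
    intro i j i' j' h
    obtain rfl : i = i' := hinj (by rw [(σ i j).2.2, (σ i' j').2.2, h])
    rw [(σ i).injective (Subtype.ext h)]
  let Φ : (∀ x, ZMod (q x ^ e x)) →+ ∀ i, PGroup (p i) (lam i) :=
    AddMonoidHom.pi fun i => AddMonoidHom.pi fun j =>
      (c i j).toAddMonoidHom.comp (Pi.evalAddMonoidHom _ (σ i j : ι))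
  have hΦ : Function.Bijective Φ := by
    constructor
    · rw [injective_iff_map_eq_zero]
      intro f hf
      funext x
      by_cases hx : e x = 0
      · have : Subsingleton (ZMod (q x ^ e x)) := by
          rw [hx, pow_zero]
          infer_instance
        exact Subsingleton.elim _ _
      · obtain ⟨i, hi⟩ := hmem x hx
        obtain ⟨j, hj⟩ := (σ i).surjective ⟨x, hx, hi⟩
        have h1 : c i j (f (σ i j)) = 0 := congrFun (congrFun hf i) j
        rw [map_eq_zero_iff _ (c i j).injective, hj] at h1
        exact h1
    · intro g
      -- Only the coordinate of F at x matters here. Stating the condition through Φ avoids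
      -- transport along σ i j = x, and the diagonal x ↦ F x x is then a preimage of g.
      have hF : ∀ x, ∃ F : ∀ x, ZMod (q x ^ e x), ∀ i j, (σ i j : ι) = x → Φ F i j = g i j := by
        intro x
        by_cases hx : ∃ i j, (σ i j : ι) = x
        · obtain ⟨i, j, rfl⟩ := hx
          refine ⟨Pi.single _ ((c i j).symm (g i j)), fun i' j' h => ?_⟩
          obtain ⟨rfl, h⟩ := Sigma.mk.inj (hσinj i' j' i j h)
          obtain rfl := eq_of_heq h
          change c i' j' (Pi.single (M := fun x => ZMod (q x ^ e x)) (σ i' j' : ι) _ _) = _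
          rw [Pi.single_eq_same, AddEquiv.apply_symm_apply]
        · exact ⟨0, fun i j h => absurd ⟨i, j, h⟩ hx⟩
      choose F hF using hF
      exact ⟨fun x => F x x, funext fun i => funext fun j => hF _ i j rfl⟩
  exact ⟨lam, Quotient.sound
    ⟨((E.trans (DirectSum.addEquivProd _)).trans (AddEquiv.ofBijective Φ hΦ)).symm⟩⟩

/-! ### Inversion of the moments -/

/-- The inversion coefficient for several primes, extended by `0` to all pairs of tuples. -/
noncomputable def invCoeffPi {k : ℕ} (p : Fin k → ℕ) (nu mu : Fin k → YoungDiagram) : ℝ :=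
  ∏ i, invCoeffExt (p i) (nu i) (mu i)

theorem invTerm_eq {k : ℕ} (p : Fin k → ℕ) (hp : ∀ i, (p i).Prime)
    (M : IsoClass (Set.range p) → ℝ) (nu : Fin k → YoungDiagram)
    (mu : {mu : Fin k → YoungDiagram // ∀ i, ConjInterlaces (mu i) (nu i)}) :
    invTerm p hp M nu mu = invCoeffPi p nu mu * M (stdGroup p hp mu) := by
  rw [invTerm, invCoeffPi]
  congr 1
  exact Finset.prod_congr rfl fun i _ => (if_pos (mu.2 i)).symm

theorem invCoeffPi_eq_zero {k : ℕ} (p : Fin k → ℕ) {nu mu : Fin k → YoungDiagram}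
    (h : ¬ ∀ i, ConjInterlaces (mu i) (nu i)) : invCoeffPi p nu mu = 0 := by
  obtain ⟨i, hi⟩ := not_forall.1 h
  exact Finset.prod_eq_zero (Finset.mem_univ i) (if_neg hi)

section

variable {k : ℕ} {p : Fin k → ℕ} (hp : ∀ i, (p i).Prime)

/-- Extension by zero makes the index set independent of ν. -/
theorem hasSum_invTerm_iff (M : IsoClass (Set.range p) → ℝ) (nu : Fin k → YoungDiagram) (a : ℝ) :
    HasSum (invTerm p hp M nu) a ↔
      HasSum (fun mu => invCoeffPi p nu mu * M (stdGroup p hp mu)) a := by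
  rw [← Function.Injective.hasSum_iff (g := (Subtype.val :
    {mu : Fin k → YoungDiagram // ∀ i, ConjInterlaces (mu i) (nu i)} → _)) Subtype.val_injective]
  · exact iff_of_eq (congrArg (HasSum · a) (funext fun mu => invTerm_eq p hp M nu mu))
  · intro mu hmu
    rw [invCoeffPi_eq_zero p (fun h => hmu ⟨⟨mu, h⟩, rfl⟩), zero_mul]

theorem summable_abs_invTerm_iff (M : IsoClass (Set.range p) → ℝ) (nu : Fin k → YoungDiagram) :
    (Summable fun mu => |invTerm p hp M nu mu|) ↔
      Summable fun mu => |invCoeffPi p nu mu * M (stdGroup p hp mu)| := by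
  rw [summable_abs_iff, summable_abs_iff]
  exact exists_congr fun a => hasSum_invTerm_iff hp M nu a

open Classical in
theorem hasSum_invCoeffPi_mul_sur (hinj : Function.Injective p) (lam nu : Fin k → YoungDiagram) :
    HasSum (fun mu => invCoeffPi p nu mu * sur (stdGroup p hp lam) (stdGroup p hp mu))
      (if lam = nu then 1 else 0) := by
  choose T hT0 hT1 using fun i => exists_sum_invCoeffExt_mul_surCard (hp i) (lam i) (nu i)
  have hterm (mu : Fin k → YoungDiagram) :
      invCoeffPi p nu mu * (sur (stdGroup p hp lam) (stdGroup p hp mu) : ℝ) =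
      ∏ i, invCoeffExt (p i) (nu i) (mu i) *
        (surCard (PGroup (p i) (lam i)) (PGroup (p i) (mu i)) : ℝ) := by
    rw [sur_stdGroup hp hinj, invCoeffPi, Finset.prod_mul_distrib, Nat.cast_prod]
  simp only [hterm]
  have hval : (if lam = nu then (1 : ℝ) else 0) = ∑ mu ∈ Fintype.piFinset T,
      ∏ i, invCoeffExt (p i) (nu i) (mu i) *
        (surCard (PGroup (p i) (lam i)) (PGroup (p i) (mu i)) : ℝ) := by
    rw [← Finset.prod_univ_sum T fun i mu => invCoeffExt (p i) (nu i) mu *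
        (surCard (PGroup (p i) (lam i)) (PGroup (p i) mu) : ℝ),
      Finset.prod_congr rfl fun i _ => hT1 i, Finset.prod_ite_zero]
    simp [funext_iff]
  rw [hval]
  refine hasSum_sum_of_ne_finset_zero fun mu hmu => ?_
  rw [Fintype.mem_piFinset] at hmu
  obtain ⟨i, hi⟩ := not_forall.1 hmu
  exact Finset.prod_eq_zero (Finset.mem_univ i) (hT0 i _ hi)

/-- Isomorphic groups receive the same value from the orthogonality sum, which is 1 at ν and 0
elsewhere; uniqueness in the structure theorem is not needed. -/
theorem stdGroup_injective (hinj : Function.Injective p) :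
    Function.Injective (stdGroup p hp) := by
  classical
  intro lam nu h
  have h1 := hasSum_invCoeffPi_mul_sur hp hinj lam nu
  have h2 := hasSum_invCoeffPi_mul_sur hp hinj nu nu
  rw [h] at h1
  by_contra hne
  simpa [hne] using h1.unique h2

end

/-! ### Moments of a random group and exchange of summation -/

instance : Countable YoungDiagram :=
  Function.Injective.countable (f := YoungDiagram.cells) fun _ _ => YoungDiagram.ext

section

variable {k : ℕ} {p : Fin k → ℕ} (hp : ∀ i, (p i).Prime) (hinj : Function.Injective p)
  {Ω : Type*} [MeasurableSpace Ω] (ℙ : Measure Ω)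
  {G : Ω → IsoClass (Set.range p)}

include hp hinj

theorem countable_isoClass : Countable (IsoClass (Set.range p)) :=
  (stdGroup_surjective p hp hinj).countable

theorem moment_eq_tsum (hG : Measurable G) (H : IsoClass (Set.range p)) :
    moment ℙ G H = ∑' lam, (sur (stdGroup p hp lam) H : ENNReal) *
      ℙ {ω | G ω = stdGroup p hp lam} := by
  have := countable_isoClass hp hinj
  have hms : MeasurableSingletonClass (IsoClass (Set.range p)) := ⟨fun _ => trivial⟩
  have hf : Measurable fun x : IsoClass (Set.range p) => (sur x H : ENNReal) := measurable_from_top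
  rw [moment, ← lintegral_map (f := fun x => (sur x H : ENNReal)) hf hG, lintegral_countable',
    ← (Equiv.ofBijective (stdGroup p hp)
      ⟨stdGroup_injective hp hinj, stdGroup_surjective p hp hinj⟩).tsum_eq]
  refine tsum_congr fun lam => ?_
  rw [Measure.map_apply hG trivial]
  rfl

theorem hasSum_moment_toReal (hG : Measurable G) {H : IsoClass (Set.range p)}
    (hfin : moment ℙ G H ≠ ⊤) :
    HasSum (fun lam => (sur (stdGroup p hp lam) H : ℝ) * ℙ.real {ω | G ω = stdGroup p hp lam})
      (moment ℙ G H).toReal := by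
  rw [moment_eq_tsum hp hinj ℙ hG] at hfin ⊢
  have h := ENNReal.hasSum_toReal hfin
  rw [← ENNReal.tsum_toReal_eq fun a => ENNReal.ne_top_of_tsum_ne_top hfin a] at h
  simpa [ENNReal.toReal_mul, Measure.real] using h

/-- The inversion formula, under absolute convergence. -/
theorem hasSum_invTerm (hG : Measurable G) (hfin : ∀ H, moment ℙ G H ≠ ⊤)
    (nu : Fin k → YoungDiagram)
    (hsum : Summable fun mu => |invTerm p hp (fun H => (moment ℙ G H).toReal) nu mu|) :
    HasSum (invTerm p hp (fun H => (moment ℙ G H).toReal) nu)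
      (ℙ.real {ω | G ω = stdGroup p hp nu}) := by
  classical
  rw [hasSum_invTerm_iff]
  rw [summable_abs_invTerm_iff] at hsum
  let F : (Fin k → YoungDiagram) × (Fin k → YoungDiagram) → ℝ := fun x =>
    invCoeffPi p nu x.1 * ((sur (stdGroup p hp x.2) (stdGroup p hp x.1) : ℝ) *
      ℙ.real {ω | G ω = stdGroup p hp x.2})
  have hrow (mu : Fin k → YoungDiagram) : HasSum (fun lam => F (mu, lam))
      (invCoeffPi p nu mu * (moment ℙ G (stdGroup p hp mu)).toReal) :=
    (hasSum_moment_toReal hp hinj ℙ hG (hfin _)).mul_left _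
  have hrow' (mu : Fin k → YoungDiagram) : HasSum (fun lam => |F (mu, lam)|)
      |invCoeffPi p nu mu * (moment ℙ G (stdGroup p hp mu)).toReal| := by
    rw [abs_mul, abs_of_nonneg ENNReal.toReal_nonneg]
    have h := (hasSum_moment_toReal hp hinj ℙ hG (hfin (stdGroup p hp mu))).mul_left
      |invCoeffPi p nu mu|
    refine h.congr_fun fun lam => ?_
    simp only [F]
    rw [abs_mul, abs_of_nonneg (mul_nonneg (Nat.cast_nonneg _) measureReal_nonneg)]
  have hF : Summable F := by
    rw [← summable_abs_iff, summable_prod_of_nonneg fun _ => abs_nonneg _]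
    refine ⟨fun mu => (hrow' mu).summable, ?_⟩
    simpa only [(hrow' _).tsum_eq] using hsum
  have h1 := hF.hasSum.prod_fiberwise hrow
  -- Summing over μ first, orthogonality leaves only λ = ν; `h1` sums over λ first and gives the
  -- inversion series.
  have h2 : HasSum (fun lam => (if lam = nu then 1 else 0) * ℙ.real {ω | G ω = stdGroup p hp lam})
      (∑' x, F x) := by
    refine ((Equiv.prodComm _ _).hasSum_iff.2 hF.hasSum).prod_fiberwise fun lam => ?_
    simpa only [F, Function.comp_def, Equiv.prodComm_apply, Prod.swap, mul_assoc] using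
      (hasSum_invCoeffPi_mul_sur hp hinj lam nu).mul_right _
  have h3 := hasSum_ite_eq nu (ℙ.real {ω | G ω = stdGroup p hp nu})
  have h4 : (fun lam => (if lam = nu then (1 : ℝ) else 0) *
      ℙ.real {ω | G ω = stdGroup p hp lam}) =
      fun lam => if lam = nu then ℙ.real {ω | G ω = stdGroup p hp nu} else 0 := by
    funext lam
    split_ifs with h
    · rw [h, one_mul]
    · rw [zero_mul]
  rw [h4] at h2
  rwa [h2.unique h3] at h1

end

end RandomAbelianGroup

theorem mainTheorem4 {k : ℕ} (p : Fin k → ℕ) (hp : ∀ i, (p i).Prime)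
    (hinj : Function.Injective p)
    {Ω : Type*} [MeasurableSpace Ω] (ℙ : Measure Ω) [IsProbabilityMeasure ℙ]
    (G : Ω → RandomAbelianGroup.IsoClass (Set.range p)) (hG : Measurable G)
    (hfin : ∀ H, RandomAbelianGroup.moment ℙ G H ≠ ⊤) :
    (∀ nu : Fin k → YoungDiagram,
      Summable (fun mu => |RandomAbelianGroup.invTerm p hp
        (fun H => (RandomAbelianGroup.moment ℙ G H).toReal) nu mu|) →
      HasSum (RandomAbelianGroup.invTerm p hp
        (fun H => (RandomAbelianGroup.moment ℙ G H).toReal) nu)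
        (ℙ.real {ω | G ω = RandomAbelianGroup.stdGroup p hp nu})) ∧
    ((∀ nu : Fin k → YoungDiagram,
      Summable (fun mu => |RandomAbelianGroup.invTerm p hp
        (fun H => (RandomAbelianGroup.moment ℙ G H).toReal) nu mu|)) →
      ∀ ρ : Measure (RandomAbelianGroup.IsoClass (Set.range p)),
        (IsProbabilityMeasure ρ ∧
          ∀ H, RandomAbelianGroup.moment ρ id H = RandomAbelianGroup.moment ℙ G H) ↔
        ρ = Measure.map G ℙ) := by
  refine ⟨RandomAbelianGroup.hasSum_invTerm hp hinj ℙ hG hfin, fun hsum ρ => ⟨?_, ?_⟩⟩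
  · rintro ⟨hρ, hmom⟩
    have hcount := RandomAbelianGroup.countable_isoClass hp hinj
    have hprob := Measure.isProbabilityMeasure_map (μ := ℙ) hG.aemeasurable
    refine Measure.ext_of_singleton fun H => ?_
    obtain ⟨nu, rfl⟩ := RandomAbelianGroup.stdGroup_surjective p hp hinj H
    have hM : (fun H => (RandomAbelianGroup.moment ρ id H).toReal) =
        fun H => (RandomAbelianGroup.moment ℙ G H).toReal := funext fun H => by rw [hmom]
    -- The inversion formula for the identity on (𝒜_P, ρ) is the same series, so ρ and the law of G
    -- have the same atoms.
    have h1 := RandomAbelianGroup.hasSum_invTerm hp hinj ρ measurable_id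
      (fun H => by rw [hmom]; exact hfin H) nu (by rw [hM]; exact hsum nu)
    rw [hM] at h1
    have h2 := h1.unique (RandomAbelianGroup.hasSum_invTerm hp hinj ℙ hG hfin nu (hsum nu))
    rw [Measure.map_apply hG trivial]
    exact (ENNReal.toReal_eq_toReal_iff' (measure_ne_top _ _) (measure_ne_top _ _)).1 h2
  · rintro rfl
    refine ⟨Measure.isProbabilityMeasure_map hG.aemeasurable, fun H => ?_⟩
    exact lintegral_map measurable_from_top hG
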